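/- Let $(\mathcal X,\Sigma)$ be a standard Borel space, $\mathcal T$ a set, and $d:\mathcal T\times\mathcal T\to[0,1]$ a premetric, i.e. $d(t,t')=d(t',t)$ and $d(t,t)=0$. Assume $(\mathcal T,d)$ is infinitely separable: there is a countable $\mathfrak T\subseteq\mathcal T$ such that for every $t\in\mathcal T$ some $d$-Cauchy sequence in $\mathfrak T$ taking infinitely many values satisfies $d(u_n,t)\to0$. Let $X=(X_t)_{t\in\mathcal T}$ be an $\mathcal X$-valued stochastic process on a probability space that is locally exchangeable with respect to $d$: for every finite $T\subset\mathcal T$ and injection $\pi:T\to\mathcal T$, the total variation distance $\sup_A|\Pr(\cdot\in A)-\Pr(\cdot\in A)|$ between the laws of $(X_t)_{t\in T}$ and $(X_{\pi(t)})_{t\in T}$ is at most $\sum_{t\in T}d(t,\pi(t))$. A directing process of $X$ is a family $G=(G_t)_{t\in\mathcal T}$ of random probability measures on $\mathcal X$, defined on the same probability space, such that for every finite $T\subset\mathcal T$ the conditional law of $(X_t)_{t\in T}$ given $\sigma(G)$ is almost surely $\prod_{t\in T}G_t$, and $\sup_{A\in\Sigma}\mathbb E|G_t(A)-G_{t'}(A)|\le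 d(t,t')$ for all $t,t'\in\mathcal T$. Let $h:\mathcal X\to[0,1]$ be measurable, $\tau\in\mathcal T$, and define $$b_{h,t}(\tau)=\inf_{\hat h}\;|\hat h|\,d(t,\tau)+2\|h-\hat h\|_\infty ,$$ where the infimum is over measurable simple functions $\hat h:\mathcal X\to[0,1]$, and $|\hat h|$ is the sum of the finitely many distinct values of $\hat h$. Let $t_1,t_2,\dots$ be distinct elements of $\mathcal T$. For each $N\ge1$, write $b_n=b_{h,t_n}(\tau)$ and let $\sigma$ be a permutation of $\{1,\dots,N\}$ with $b_{\sigma(1)}\le\dots\le b_{\sigma(N)}$ (ties broken arbitrarily). Set $$M=\max\Big\{J\in\{1,\dots,N\}:\tfrac1J\Big(1+\sum_{i=1}^J2b_{\sigma(i)}\Big)>2b_{\sigma(J)}\Big\},$$ $\xi_{\sigma(j)}=-2b_{\sigma(j)}+\frac1M\big(1+\sum_{i=1}^M2b_{\sigma(i)}\big)$ for $j\le M$, $\xi_{\sigma(j)}=0$ for $j>M$, and $\hat G_\tau=\sum_{n=1}^N\xi_n\delta_{X_{t_n}}$ (so $\xi$ and $\hat G_\tau$ depend on $N$). Write $G_\tau(h)=\int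 h\,dG_\tau$ and $\hat G_\tau(h)=\int h\,d\hat G_\tau$. Then the following hold as $N\to\infty$. 1. The squared-error bound $\frac14\sum_{n\le N}\xi_n^2+\sum_{n\le N}\xi_nb_n$ converges to $0$ if and only if there is a subsequence $(t_{n_i})_{i\ge1}$ with $b_{h,t_{n_i}}(\tau)\to0$. 2. For every $\delta>0$, the tail bound $\inf_{\epsilon\in(0,\delta)}\Big[2\exp\Big(-\frac{2\epsilon^2}{\sum_{n\le N}\xi_n^2}\Big)+(\delta-\epsilon)^{-1}\sum_{n\le N}\xi_nb_n\Big]$ converges to $0$ if and only if there is such a subsequence. 3. If there is such a subsequence (equivalently, if the bounds converge to $0$), then $\hat G_\tau(h)\to G_\tau(h)$ in probability for every directing process $G$ of $X$. -/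

import Mathlib

open MeasureTheory ProbabilityTheory Filter Topology

noncomputable section

namespace LocalExch

/-- A premetric with values in `[0,1]`: symmetric and zero on the diagonal. -/
structure IsPremetric {T : Type*} (d : T → T → ℝ) : Prop where
  nonneg : ∀ s t, 0 ≤ d s t
  le_one : ∀ s t, d s t ≤ 1
  symm : ∀ s t, d s t = d t s
  self : ∀ t, d t t = 0

/-- There is a countable set `S` such that every point is the limit of a Cauchy sequence of
points of `S` that takes infinitely many values. -/
def InfinitelySeparable {T : Type*} (d : T → T → ℝ) : Prop :=
  ∃ S : Set T, S.Countable ∧ ∀ t : T, ∃ u : ℕ → T,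
    (∀ n, u n ∈ S) ∧
    (∀ ε > 0, ∃ N, ∀ m ≥ N, ∀ n ≥ N, d (u m) (u n) < ε) ∧
    Tendsto (fun n => d (u n) t) atTop (𝓝 0) ∧
    (Set.range u).Infinite

/-- Total variation distance `sup_A |μ(A) - ν(A)|` (used for probability measures). -/
def tvDist {Y : Type*} [MeasurableSpace Y] (μ ν : Measure Y) : ℝ :=
  ⨆ A : {A : Set Y // MeasurableSet A}, |μ.real A - ν.real A|

/-- Local exchangeability of the process `X` with respect to `d`: for every finite set `S` of
covariates and injection `π : S → T`, the laws of `(X_t)_{t ∈ S}` and `(X_{π(t)})_{t ∈ S}` are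
within `∑_{t ∈ S} d(t, π(t))` in total variation. -/
def LocallyExchangeable {Ω E T : Type*} [MeasurableSpace Ω] [MeasurableSpace E]
    (P : Measure Ω) (X : T → Ω → E) (d : T → T → ℝ) : Prop :=
  ∀ (S : Finset T) (π : S → T), Function.Injective π →
    tvDist (P.map (fun ω (t : S) => X t ω)) (P.map (fun ω (t : S) => X (π t) ω))
      ≤ ∑ t : S, d t (π t)

/-- The sigma-algebra generated by a family of random measures. -/
abbrev sigmaOf {Ω E T : Type*} [MeasurableSpace Ω] [MeasurableSpace E]
    (G : T → Kernel Ω E) : MeasurableSpace Ω :=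
  ⨆ t, MeasurableSpace.comap (fun ω => G t ω) inferInstance

/-- `G = (G_t)` is the de Finetti directing process of `X`: the `G_t` are random probability
measures, for every finite set `S` of covariates the conditional law of `X_S` given `G` is the
product of the `G_t`, and `sup_A E|G_s(A) - G_t(A)| ≤ d(s,t)`. -/
structure IsDirectingProcess {Ω E T : Type*} [MeasurableSpace Ω] [MeasurableSpace E]
    (P : Measure Ω) (X : T → Ω → E) (d : T → T → ℝ) (G : T → Kernel Ω E) : Prop where
  prob : ∀ t, IsMarkovKernel (G t)
  cond : ∀ (S : Finset T) (B : Set (S → E)), MeasurableSet B →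
    P[((fun ω (t : S) => X t ω) ⁻¹' B).indicator (fun _ => (1 : ℝ)) | sigmaOf G]
      =ᵐ[P] fun ω => (Measure.pi (fun t : S => G t ω)).real B
  smooth : ∀ (s t : T) (A : Set E), MeasurableSet A →
    ∫ ω, |(G s ω).real A - (G t ω).real A| ∂P ≤ d s t

/-- Simple functions `E → [0,1]`, with any finite number of levels. -/
abbrev UnitSimple (E : Type*) [MeasurableSpace E] : Type _ :=
  {f : SimpleFunc E ℝ // ∀ x, 0 ≤ f x ∧ f x ≤ 1}

/-- `|f|`, the sum of the levels of a simple function. -/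
def levelSum {E : Type*} [MeasurableSpace E] (f : SimpleFunc E ℝ) : ℝ :=
  ∑ y ∈ f.range, y

/-- `b_{h,t}(τ) = inf_f |f| d(t,τ) + 2 ‖h - f‖_∞`, over all simple `f : E → [0,1]`. -/
def bCoef {E T : Type*} [MeasurableSpace E] (d : T → T → ℝ) (h : E → ℝ) (t τ : T) : ℝ :=
  ⨅ f : UnitSimple E, levelSum f.1 * d t τ + 2 * ⨆ x, |h x - f.1 x|

/-- `(1/J) (1 + ∑_{i ≤ J} 2 c_i)`; the `i`-th entry of the list is `c ⟨i - 1, _⟩`. -/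
def prefixLevel {N : ℕ} (c : Fin N → ℝ) (J : ℕ) : ℝ :=
  (1 / (J : ℝ)) * (1 + ∑ i : Fin N with i.val < J, 2 * c i)

open Classical in
/-- `M = max {J ∈ {1,…,N} : (1/J) (1 + ∑_{i ≤ J} 2 c_i) > 2 c_J}` for an increasing list `c`;
`J` is written as `j + 1` with `j : Fin N`. -/
def cutoff {N : ℕ} (c : Fin N → ℝ) : ℕ :=
  (Finset.univ.filter (fun j : Fin N => prefixLevel c (j.val + 1) > 2 * c j)).sup
    (fun j => j.val + 1)

/-- The output of the weighting algorithm on the list `b` of coefficients, sorted by means of the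
permutation `σ` (so `b ∘ σ` is increasing): the `j`-th entry in sorted order has weight
`-2 b_j + (1/M) (1 + ∑_{i ≤ M} 2 b_i)` if `j ≤ M`, and weight `0` otherwise. -/
def algWeights {N : ℕ} (b : Fin N → ℝ) (σ : Equiv.Perm (Fin N)) (n : Fin N) : ℝ :=
  if (σ.symm n).val < cutoff (b ∘ σ) then -2 * b n + prefixLevel (b ∘ σ) (cutoff (b ∘ σ)) else 0

/-- The weighted empirical measure `∑_n ξ_n δ_{x_n}`. -/
def localEmpirical {E : Type*} [MeasurableSpace E] {N : ℕ} (ξ : Fin N → ℝ) (x : Fin N → E) :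
    Measure E :=
  ∑ n, ENNReal.ofReal (ξ n) • Measure.dirac (x n)

/-- The bound `(1/4) ∑ ξ_n² + ∑ ξ_n b_n` on the expected squared error. -/
def sqErrorBound {N : ℕ} (ξ b : Fin N → ℝ) : ℝ :=
  (1 / 4) * ∑ n, ξ n ^ 2 + ∑ n, ξ n * b n

/-- The bound `inf_{0<ε<δ} 2 exp(-2 ε² / ∑ ξ_n²) + (δ - ε)⁻¹ ∑ ξ_n b_n` on the probability of an
error above `δ`. -/
def tailBound {N : ℕ} (ξ b : Fin N → ℝ) (δ : ℝ) : ℝ :=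
  ⨅ ε : Set.Ioo (0 : ℝ) δ,
    (2 * Real.exp (-(2 * (ε : ℝ) ^ 2) / ∑ n, ξ n ^ 2) + (δ - ε)⁻¹ * ∑ n, ξ n * b n)

/-- The coefficients of the first `N` covariates. -/
def coefs {E T : Type*} [MeasurableSpace E] (d : T → T → ℝ) (h : E → ℝ) (t : ℕ → T) (τ : T)
    (N : ℕ) : Fin N → ℝ :=
  fun n => bCoef d h (t n) τ

end LocalExch

end

namespace LocalExch

/-! ### The weighting algorithm -/

/-! The weights come from water-filling: they satisfy the optimality conditions of the convex
programme that minimises the squared-error bound over the simplex, so any other probability vector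
gives an upper bound for the optimum (`isOptimal_algWeights`, `IsOptimal.sqErrorBound_le`). Write Q
= ∑ ξ_n² and R = ∑ ξ_n b_n. Each of the two bounds tends to 0 exactly when Q and R both do. If b
tends to 0 along a subsequence, uniform weights on many of its late indices have small squared-error
bound, hence so does ξ. Conversely, if b stays above some ε from an index on, then Q → 0 empties the
initial segment and R → 0 empties the rest, against total mass 1 (`exists_subseq_of_tendsto`). For
consistency, the error splits as ∑ ξ_n (h(X_{t_n}) - G_{t_n}(h)) + ∑ ξ_n (G_{t_n}(h) - G_τ(h)).
Given G the terms of the first sum are centred and pairwise independent, so its L² norm is at most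
√Q; approximating h by simple functions bounds the L¹ norm of the second by R. Thus the L¹ error is
at most √Q + R (`IsDirectingProcess.integral_abs_error_le`). -/

/-- A weight vector in the simplex satisfying the optimality conditions of the quadratic programme
`min (1/4) ∑ ξ_n² + ∑ ξ_n b_n`. -/
structure IsOptimal {N : ℕ} (ξ b : Fin N → ℝ) : Prop where
  nonneg : ∀ n, 0 ≤ ξ n
  sum_eq_one : ∑ n, ξ n = 1
  kkt : ∃ l : ℝ, ∀ n, ξ n / 2 + b n = l ∨ ξ n = 0 ∧ l ≤ b n

/-- Each summand is a convex parabola lying above its tangent at ξ_n, whose slope is l, or at least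
l where ξ_n = 0. On summation the l terms cancel because both vectors have mass 1. -/
theorem IsOptimal.sqErrorBound_le {N : ℕ} {ξ b w : Fin N → ℝ} (hξ : IsOptimal ξ b)
    (hw : ∀ n, 0 ≤ w n) (hw1 : ∑ n, w n = 1) : sqErrorBound ξ b ≤ sqErrorBound w b := by
  obtain ⟨l, hl⟩ := hξ.kkt
  have key : ∀ n, l * (w n - ξ n) ≤
      (1 / 4 * w n ^ 2 + w n * b n) - (1 / 4 * ξ n ^ 2 + ξ n * b n) := by
    intro n
    rcases hl n with h | ⟨h, h'⟩
    · rw [← h]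
      nlinarith [sq_nonneg (w n - ξ n)]
    · rw [h]
      nlinarith [sq_nonneg (w n), mul_le_mul_of_nonneg_left h' (hw n)]
  have := Finset.sum_le_sum fun n (_ : n ∈ Finset.univ) => key n
  rw [← Finset.mul_sum, Finset.sum_sub_distrib, Finset.sum_sub_distrib, hw1, hξ.sum_eq_one,
    Finset.sum_add_distrib, Finset.sum_add_distrib, ← Finset.mul_sum, ← Finset.mul_sum] at this
  unfold sqErrorBound
  linarith

theorem mul_prefixLevel {N : ℕ} (c : Fin N → ℝ) {J : ℕ} (hJ : 0 < J) :
    J * prefixLevel c J = 1 + ∑ i : Fin N with i.val < J, 2 * c i := by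
  have : (J : ℝ) ≠ 0 := by positivity
  unfold prefixLevel
  field_simp

theorem mul_prefixLevel_succ {N : ℕ} (c : Fin N → ℝ) (j : Fin N) (hj : 0 < j.val) :
    ((j.val + 1 : ℕ) : ℝ) * prefixLevel c (j.val + 1)
      = j.val * prefixLevel c j.val + 2 * c j := by
  rw [mul_prefixLevel c (Nat.succ_pos _), mul_prefixLevel c hj]
  have : (Finset.univ.filter fun i : Fin N => i.val < j.val + 1)
      = insert j (Finset.univ.filter fun i : Fin N => i.val < j.val) := by
    ext i
    simp only [Finset.mem_filter, Finset.mem_univ, true_and, Finset.mem_insert, Fin.ext_iff]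
    omega
  rw [this, Finset.sum_insert (by simp)]
  ring

theorem le_cutoff {N : ℕ} (c : Fin N → ℝ) (j : Fin N)
    (hj : prefixLevel c (j.val + 1) > 2 * c j) : j.val + 1 ≤ cutoff c := by
  classical
  unfold cutoff
  exact Finset.le_sup (f := fun j : Fin N => j.val + 1) (by simpa using hj)

theorem exists_cutoff_eq {N : ℕ} (c : Fin N → ℝ) (hN : 0 < N) :
    ∃ j : Fin N, cutoff c = j.val + 1 ∧ prefixLevel c (j.val + 1) > 2 * c j := by
  classical
  have hne : (Finset.univ.filter
      (fun j : Fin N => prefixLevel c (j.val + 1) > 2 * c j)).Nonempty := by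
    -- J = 1 always passes, as 1 + 2 c_1 > 2 c_1; so the maximum is attained and is not the default
    -- 0 of an empty `sup`.
    refine ⟨⟨0, hN⟩, ?_⟩
    simp only [Finset.mem_filter, Finset.mem_univ, true_and]
    have : (Finset.univ.filter fun i : Fin N => i.val < 0 + 1) = {⟨0, hN⟩} := by
      ext i
      simp [Fin.ext_iff]
    simp only [prefixLevel, this, Finset.sum_singleton]
    norm_num
  obtain ⟨j, hj, h⟩ := Finset.exists_mem_eq_sup _ hne (fun j : Fin N => j.val + 1)
  exact ⟨j, by unfold cutoff; convert h, by simpa using hj⟩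

/-- The level at M + 1 is a weighted average of the level at M and twice the next coefficient. That
position fails the test, so the level at M is at most this coefficient doubled; monotonicity carries
this further. -/
theorem prefixLevel_cutoff_le {N : ℕ} (c : Fin N → ℝ) (hN : 0 < N) (hc : Monotone c) (j : Fin N)
    (hj : cutoff c ≤ j.val) : prefixLevel c (cutoff c) ≤ 2 * c j := by
  obtain ⟨i, hi, -⟩ := exists_cutoff_eq c hN
  have hpos : 0 < cutoff c := by omega
  -- Counting from zero, index M is position M + 1 of the sorted list, the first one past the
  -- cutoff.
  let k : Fin N := ⟨cutoff c, hj.trans_lt j.2⟩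
  have hk : prefixLevel c (k.val + 1) ≤ 2 * c k := by
    by_contra! h
    exact absurd (le_cutoff c k h) (by simp [k])
  have h1 := mul_prefixLevel_succ c k hpos
  have h2 : c k ≤ c j := hc hj
  have h3 : ((k.val + 1 : ℕ) : ℝ) * prefixLevel c (k.val + 1)
      ≤ ((k.val + 1 : ℕ) : ℝ) * (2 * c k) := mul_le_mul_of_nonneg_left hk (by positivity)
  push_cast at h1 h3
  have h4 : (cutoff c : ℝ) * prefixLevel c (cutoff c) ≤ cutoff c * (2 * c k) := by
    change (k.val : ℝ) * prefixLevel c k.val ≤ k.val * (2 * c k)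
    linarith
  have h5 := le_of_mul_le_mul_left h4 (by exact_mod_cast hpos)
  linarith

/-- The multiplier is half the level at M. Passing the test at M gives nonnegative weights, and
maximality of M gives the inequality off the support. -/
theorem isOptimal_algWeights {N : ℕ} (hN : 0 < N) (b : Fin N → ℝ) (σ : Equiv.Perm (Fin N))
    (hσ : Monotone (b ∘ σ)) : IsOptimal (algWeights b σ) b := by
  obtain ⟨j, hj, hlt⟩ := exists_cutoff_eq (b ∘ σ) hN
  refine ⟨fun n => ?_, ?_, prefixLevel (b ∘ σ) (cutoff (b ∘ σ)) / 2, fun n => ?_⟩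
  · unfold algWeights
    split_ifs with h
    · have h1 : (b ∘ σ) (σ.symm n) ≤ (b ∘ σ) j := hσ (by rw [Fin.le_def]; omega)
      rw [← hj] at hlt
      simp only [Function.comp_apply, Equiv.apply_symm_apply] at h1 hlt
      linarith
    · exact le_rfl
  · have hpos : 0 < cutoff (b ∘ σ) := by omega
    have hcard : (Finset.univ.filter fun i : Fin N => i.val < cutoff (b ∘ σ)).card
        = cutoff (b ∘ σ) := by
      rw [Fin.card_filter_val_lt]
      omega
    rw [← Equiv.sum_comp σ]
    simp only [algWeights, Equiv.symm_apply_apply]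
    -- M copies of the level add up to 1 + ∑ 2b, and the subtracted 2b cancel.
    rw [← Finset.sum_filter, Finset.sum_add_distrib, Finset.sum_const, hcard, nsmul_eq_mul,
      mul_prefixLevel _ hpos, add_left_comm, ← Finset.sum_add_distrib]
    simp
  · unfold algWeights
    split_ifs with h
    · left
      ring
    · right
      have := prefixLevel_cutoff_le (b ∘ σ) hN hσ (σ.symm n) (not_lt.1 h)
      simp only [Function.comp_apply, Equiv.apply_symm_apply] at this
      exact ⟨rfl, by simp only [Function.comp_def] at this ⊢; linarith⟩

/-! ### Asymptotics of the weights -/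

theorem exists_subseq_tendsto_zero {b : ℕ → ℝ} (hb : ∀ n, 0 ≤ b n)
    (hf : ∀ ε > 0, ∃ᶠ n in atTop, b n < ε) :
    ∃ φ : ℕ → ℕ, StrictMono φ ∧ Tendsto (fun i => b (φ i)) atTop (𝓝 0) := by
  obtain ⟨φ, hφ, h⟩ := extraction_forall_of_frequently
    (P := fun n k => b k < 1 / ((n : ℝ) + 1)) fun n => hf _ (by positivity)
  exact ⟨φ, hφ, squeeze_zero (fun _ => hb _) (fun i => (h i).le)
    tendsto_one_div_add_atTop_nhds_zero_nat⟩

theorem sum_fin_ite_lt_le {a : ℝ} (ha : 0 ≤ a) (N K : ℕ) :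
    ∑ n : Fin N, (if n.val < K then a else 0) ≤ K * a := by
  rw [← Finset.sum_filter, Finset.sum_const, Fin.card_filter_val_lt, nsmul_eq_mul]
  exact mul_le_mul_of_nonneg_right (by exact_mod_cast min_le_right _ _) ha

theorem exists_subseq_of_tendsto {b : ℕ → ℝ} (hb : ∀ n, 0 ≤ b n) {ξ : ∀ N, Fin N → ℝ}
    (hξ : ∀ N, 0 < N → IsOptimal (ξ N) fun n => b n)
    (hQ : Tendsto (fun N => ∑ n, ξ N n ^ 2) atTop (𝓝 0))
    (hR : Tendsto (fun N => ∑ n, ξ N n * b n) atTop (𝓝 0)) :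
    ∃ φ : ℕ → ℕ, StrictMono φ ∧ Tendsto (fun i => b (φ i)) atTop (𝓝 0) := by
  refine exists_subseq_tendsto_zero hb fun ε hε => ?_
  by_contra hcon
  rw [not_frequently, eventually_atTop] at hcon
  obtain ⟨K, hK⟩ := hcon
  -- Chosen so that K a ≤ 1/2, including when K = 0. Below K the estimate ξ ≤ a + ξ²/(4a) is used,
  -- from K on ξ ≤ ε⁻¹ ξ b.
  set a : ℝ := 1 / (2 * ((K : ℝ) + 1)) with ha
  have ha0 : 0 < a := by positivity
  have hKa : K * a ≤ 1 / 2 := by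
    rw [ha, mul_one_div, div_le_div_iff₀ (by positivity) (by norm_num)]
    linarith
  have bound : ∀ N, 0 < N →
      1 ≤ 1 / 2 + (4 * a)⁻¹ * (∑ n, ξ N n ^ 2) + ε⁻¹ * ∑ n, ξ N n * b n := by
    intro N hN
    have h1 : ∀ n : Fin N, ξ N n ≤
        (if n.val < K then a else 0) + (4 * a)⁻¹ * ξ N n ^ 2 + ε⁻¹ * (ξ N n * b n) := by
      intro n
      have h0 := (hξ N hN).nonneg n
      have hb0 := hb n
      split_ifs with h
      · have h2 : 0 ≤ ε⁻¹ * (ξ N n * b n) := by positivity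
        have h3 : ξ N n ≤ a + (4 * a)⁻¹ * ξ N n ^ 2 := by
          have : a + (4 * a)⁻¹ * ξ N n ^ 2 - ξ N n = (4 * a)⁻¹ * (ξ N n - 2 * a) ^ 2 := by
            field_simp
            ring
          have h4 : 0 ≤ (4 * a)⁻¹ * (ξ N n - 2 * a) ^ 2 := by positivity
          linarith
        linarith
      · have h2 : ε ≤ b n := not_lt.1 (hK n (not_lt.1 h))
        have h3 : 0 ≤ (4 * a)⁻¹ * ξ N n ^ 2 := by positivity
        have h4 : ξ N n ≤ ε⁻¹ * (ξ N n * b n) := by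
          rw [inv_mul_eq_div, le_div_iff₀ hε]
          exact mul_le_mul_of_nonneg_left h2 h0
        linarith
    have h2 := Finset.sum_le_sum fun n (_ : n ∈ Finset.univ) => h1 n
    rw [(hξ N hN).sum_eq_one, Finset.sum_add_distrib, Finset.sum_add_distrib, ← Finset.mul_sum,
      ← Finset.mul_sum] at h2
    linarith [sum_fin_ite_lt_le ha0.le N K]
  have hlim : Tendsto (fun N => 1 / 2 + (4 * a)⁻¹ * (∑ n, ξ N n ^ 2) + ε⁻¹ * ∑ n, ξ N n * b n)
      atTop (𝓝 (1 / 2 + (4 * a)⁻¹ * 0 + ε⁻¹ * 0)) :=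
    (tendsto_const_nhds.add (hQ.const_mul _)).add (hR.const_mul _)
  have := ge_of_tendsto hlim ((eventually_gt_atTop 0).mono bound)
  norm_num at this

theorem tendsto_sqErrorBound {b : ℕ → ℝ} (hb : ∀ n, 0 ≤ b n) {ξ : ∀ N, Fin N → ℝ}
    (hξ : ∀ N, 0 < N → IsOptimal (ξ N) fun n => b n)
    (hφ : ∃ φ : ℕ → ℕ, StrictMono φ ∧ Tendsto (fun i => b (φ i)) atTop (𝓝 0)) :
    Tendsto (fun N => sqErrorBound (ξ N) fun n => b n) atTop (𝓝 0) := by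
  obtain ⟨φ, hφ, hlim⟩ := hφ
  rw [Metric.tendsto_atTop]
  intro ε hε
  obtain ⟨i₀, hi₀⟩ := eventually_atTop.1 (hlim.eventually_lt_const (half_pos hε))
  obtain ⟨k, hk⟩ := exists_nat_one_div_lt (half_pos hε)
  -- Support of the competitor: k + 1 late indices of the subsequence. Its uniform weights give at
  -- most 1/(4(k+1)) + ε/2 < ε.
  set S : Finset ℕ := (Finset.Ico i₀ (i₀ + (k + 1))).image φ with hS
  have hcard : S.card = k + 1 := by
    rw [hS, Finset.card_image_of_injective _ hφ.injective, Nat.card_Ico]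
    omega
  refine ⟨φ (i₀ + (k + 1)) + 1, fun N hN => ?_⟩
  have hSN : ∀ n ∈ S, n < N := by
    intro n hn
    obtain ⟨i, hi, rfl⟩ := Finset.mem_image.1 hn
    have := hφ.monotone (Finset.mem_Ico.1 hi).2.le
    omega
  have hSb : ∀ n ∈ S, b n < ε / 2 := by
    intro n hn
    obtain ⟨i, hi, rfl⟩ := Finset.mem_image.1 hn
    exact hi₀ i (Finset.mem_Ico.1 hi).1
  have hN0 : 0 < N := by omega
  have hsum : ∀ f : ℕ → ℝ, ∑ n : Fin N, (if n.val ∈ S then f n else 0) = ∑ n ∈ S, f n := by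
    intro f
    rw [Fin.sum_univ_eq_sum_range (fun n => if n ∈ S then f n else 0) N, ← Finset.sum_filter]
    refine Finset.sum_congr ?_ fun _ _ => rfl
    ext n
    simp only [Finset.mem_filter, Finset.mem_range]
    exact ⟨fun h => h.2, fun h => ⟨hSN n h, h⟩⟩
  have hk0 : (0 : ℝ) < k + 1 := by positivity
  set w : Fin N → ℝ := fun n => if n.val ∈ S then 1 / ((k : ℝ) + 1) else 0 with hw
  have hw0 : ∀ n, 0 ≤ w n := by
    intro n
    simp only [hw]
    split_ifs <;> positivity
  have hw1 : ∑ n, w n = 1 := by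
    simp only [hw]
    rw [hsum fun _ => 1 / ((k : ℝ) + 1), Finset.sum_const, hcard, nsmul_eq_mul]
    push_cast
    field_simp
  have hle := (hξ N hN0).sqErrorBound_le hw0 hw1
  have hwsq : ∑ n, w n ^ 2 = 1 / ((k : ℝ) + 1) := by
    have : ∀ n, w n ^ 2 = 1 / ((k : ℝ) + 1) * w n := by
      intro n
      simp only [hw]
      split_ifs <;> ring
    simp_rw [this]
    rw [← Finset.mul_sum, hw1, mul_one]
  have hwb : ∑ n, w n * b n ≤ ε / 2 := by
    calc ∑ n, w n * b n ≤ ∑ n, w n * (ε / 2) := by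
          refine Finset.sum_le_sum fun n _ => ?_
          by_cases hn : n.val ∈ S
          · exact mul_le_mul_of_nonneg_left (hSb _ hn).le (hw0 n)
          · simp [hw, hn]
      _ = ε / 2 := by rw [← Finset.sum_mul, hw1, one_mul]
  have hpos : 0 ≤ sqErrorBound (ξ N) fun n => b n := by
    unfold sqErrorBound
    have := Finset.sum_nonneg fun n (_ : n ∈ Finset.univ) =>
      mul_nonneg ((hξ N hN0).nonneg n) (hb n)
    positivity
  rw [Real.dist_eq, sub_zero, abs_of_nonneg hpos]
  have : sqErrorBound w (fun n => b n) = 1 / 4 * ∑ n, w n ^ 2 + ∑ n, w n * b n := rfl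
  rw [hwsq] at this
  have : 0 < 1 / ((k : ℝ) + 1) := by positivity
  linarith

/-! ### Both bounds vanish exactly when ∑ ξ_n² and ∑ ξ_n b_n do -/

theorem tendsto_sqErrorBound_iff {b : ℕ → ℝ} (hb : ∀ n, 0 ≤ b n) {ξ : ∀ N, Fin N → ℝ}
    (hξ : ∀ N, 0 < N → IsOptimal (ξ N) fun n => b n) :
    Tendsto (fun N => sqErrorBound (ξ N) fun n => b n) atTop (𝓝 0) ↔
      Tendsto (fun N => ∑ n, ξ N n ^ 2) atTop (𝓝 0) ∧
        Tendsto (fun N => ∑ n, ξ N n * b n) atTop (𝓝 0) := by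
  have hR0 : ∀ᶠ N in atTop, 0 ≤ ∑ n, ξ N n * b n := (eventually_gt_atTop 0).mono fun N hN =>
    Finset.sum_nonneg fun n _ => mul_nonneg ((hξ N hN).nonneg n) (hb n)
  have hQ0 : ∀ N, 0 ≤ ∑ n, ξ N n ^ 2 := fun N => by positivity
  constructor
  · intro h
    refine ⟨squeeze_zero' (Eventually.of_forall hQ0) ?_ (by simpa using h.const_mul 4),
      squeeze_zero' hR0 (Eventually.of_forall fun N => ?_) h⟩
    · filter_upwards [hR0] with N hN
      unfold sqErrorBound
      linarith
    · unfold sqErrorBound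
      linarith [hQ0 N]
  · rintro ⟨h1, h2⟩
    simpa only [sqErrorBound, mul_zero, add_zero] using (h1.const_mul (1 / 4)).add h2

theorem tendsto_zero_of_tendsto_exp_neg_div {Q : ℕ → ℝ} {c : ℝ} (hc : 0 < c)
    (hQ : ∀ᶠ N in atTop, 0 < Q N)
    (h : Tendsto (fun N => Real.exp (-c / Q N)) atTop (𝓝 0)) : Tendsto Q atTop (𝓝 0) := by
  have h1 : Tendsto (fun N => -c / Q N) atTop atBot := Real.tendsto_exp_comp_nhds_zero.1 h
  have h2 : Tendsto (fun N => -c * (-c / Q N)⁻¹) atTop (𝓝 (-c * 0)) :=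
    h1.inv_tendsto_atBot.const_mul _
  rw [mul_zero] at h2
  refine h2.congr' ?_
  filter_upwards [hQ] with N hN
  field_simp

theorem tendsto_exp_neg_div_of_tendsto_zero {Q : ℕ → ℝ} {c : ℝ} (hc : 0 < c)
    (hQ : ∀ᶠ N in atTop, 0 < Q N) (h : Tendsto Q atTop (𝓝 0)) :
    Tendsto (fun N => Real.exp (-c / Q N)) atTop (𝓝 0) := by
  rw [Real.tendsto_exp_comp_nhds_zero]
  have h1 : Tendsto (fun N => (Q N)⁻¹) atTop atTop :=
    (tendsto_nhdsWithin_iff.2 ⟨h, hQ⟩).inv_tendsto_nhdsGT_zero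
  simpa only [div_eq_mul_inv] using h1.const_mul_atTop_of_neg (neg_lt_zero.2 hc)

/-- The infimum lies between two expressions of the same shape: below, both ε and δ - ε are replaced
by δ; above, ε = δ/2 is inserted. -/
theorem tendsto_tailBound_iff {b : ℕ → ℝ} (hb : ∀ n, 0 ≤ b n) {ξ : ∀ N, Fin N → ℝ}
    (hξ : ∀ N, 0 < N → IsOptimal (ξ N) fun n => b n) {δ : ℝ} (hδ : 0 < δ) :
    Tendsto (fun N => tailBound (ξ N) (fun n => b n) δ) atTop (𝓝 0) ↔
      Tendsto (fun N => ∑ n, ξ N n ^ 2) atTop (𝓝 0) ∧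
        Tendsto (fun N => ∑ n, ξ N n * b n) atTop (𝓝 0) := by
  have hR0 : ∀ᶠ N in atTop, 0 ≤ ∑ n, ξ N n * b n := (eventually_gt_atTop 0).mono fun N hN =>
    Finset.sum_nonneg fun n _ => mul_nonneg ((hξ N hN).nonneg n) (hb n)
  -- Mass 1 excludes Q = 0, where division by zero would make the exponential equal to 1.
  have hQ0 : ∀ᶠ N in atTop, 0 < ∑ n, ξ N n ^ 2 := by
    filter_upwards [eventually_gt_atTop 0] with N hN
    refine (Finset.sum_nonneg fun n _ => sq_nonneg _).lt_of_ne' fun h0 => ?_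
    have h1 : ∀ n, ξ N n = 0 := fun n => by
      simpa using (Finset.sum_eq_zero_iff_of_nonneg fun n _ => sq_nonneg _).1 h0 n
        (Finset.mem_univ n)
    simpa [h1] using (hξ N hN).sum_eq_one
  have : Nonempty (Set.Ioo (0 : ℝ) δ) := ⟨⟨δ / 2, half_pos hδ, half_lt_self hδ⟩⟩
  have hlow : ∀ᶠ N in atTop, 2 * Real.exp (-(2 * δ ^ 2) / ∑ n, ξ N n ^ 2)
      + δ⁻¹ * ∑ n, ξ N n * b n ≤ tailBound (ξ N) (fun n => b n) δ := by
    filter_upwards [hR0, hQ0] with N hR hQ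
    refine le_ciInf fun ⟨ε, hε0, hεδ⟩ => ?_
    have h1 : (0 : ℝ) < δ - ε := sub_pos.2 hεδ
    have h2 : ε ^ 2 ≤ δ ^ 2 := by nlinarith
    dsimp only
    gcongr
    linarith
  have hup : ∀ᶠ N in atTop, tailBound (ξ N) (fun n => b n) δ ≤
      2 * Real.exp (-(2 * (δ / 2) ^ 2) / ∑ n, ξ N n ^ 2)
        + (δ - δ / 2)⁻¹ * ∑ n, ξ N n * b n := by
    filter_upwards [hR0] with N hR
    refine ciInf_le (f := fun ε : Set.Ioo (0 : ℝ) δ =>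
      2 * Real.exp (-(2 * (ε : ℝ) ^ 2) / ∑ n, ξ N n ^ 2) + (δ - ε)⁻¹ * ∑ n, ξ N n * b n)
      ⟨0, ?_⟩ ⟨δ / 2, half_pos hδ, half_lt_self hδ⟩
    rintro _ ⟨⟨ε, hε0, hεδ⟩, rfl⟩
    have h1 : (0 : ℝ) < δ - ε := sub_pos.2 hεδ
    dsimp only
    positivity
  constructor
  · intro h
    have hsum : Tendsto (fun N => 2 * Real.exp (-(2 * δ ^ 2) / ∑ n, ξ N n ^ 2)
        + δ⁻¹ * ∑ n, ξ N n * b n) atTop (𝓝 0) :=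
      squeeze_zero' (hR0.mono fun N hN => by positivity) hlow h
    constructor
    · refine tendsto_zero_of_tendsto_exp_neg_div (c := 2 * δ ^ 2) (by positivity) hQ0 ?_
      refine squeeze_zero' (Eventually.of_forall fun N => (Real.exp_pos _).le) ?_ hsum
      filter_upwards [hR0] with N hN
      have h1 := Real.exp_pos (-(2 * δ ^ 2) / ∑ n, ξ N n ^ 2)
      have h2 : 0 ≤ δ⁻¹ * ∑ n, ξ N n * b n := by positivity
      linarith
    · have h1 : Tendsto (fun N => δ⁻¹ * ∑ n, ξ N n * b n) atTop (𝓝 0) :=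
        squeeze_zero' (hR0.mono fun N hN => by positivity)
          (Eventually.of_forall fun N => by
            linarith [Real.exp_pos (-(2 * δ ^ 2) / ∑ n, ξ N n ^ 2)]) hsum
      have h2 := h1.const_mul δ
      rw [mul_zero] at h2
      refine h2.congr fun N => ?_
      rw [← mul_assoc, mul_inv_cancel₀ hδ.ne', one_mul]
  · rintro ⟨h1, h2⟩
    refine squeeze_zero' (hlow.and hR0 |>.mono fun N hN =>
      le_trans (have := hN.2; by positivity) hN.1) hup ?_
    simpa using ((tendsto_exp_neg_div_of_tendsto_zero (c := 2 * (δ / 2) ^ 2) (by positivity) hQ0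
      h1).const_mul 2).add (h2.const_mul (δ - δ / 2)⁻¹)

end LocalExch

namespace LocalExch

/-! ### Smoothness of the directing process -/

theorem levelSum_nonneg {E : Type*} [MeasurableSpace E] (f : UnitSimple E) : 0 ≤ levelSum f.1 := by
  refine Finset.sum_nonneg fun y hy => ?_
  obtain ⟨x, rfl⟩ := SimpleFunc.mem_range.1 hy
  exact (f.2 x).1

theorem bCoef_nonneg {E T : Type*} [MeasurableSpace E] {d : T → T → ℝ} (hd : IsPremetric d)
    (h : E → ℝ) (t τ : T) : 0 ≤ bCoef d h t τ :=
  Real.iInf_nonneg fun f => add_nonneg (mul_nonneg (levelSum_nonneg f) (hd.nonneg _ _))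
    (mul_nonneg zero_le_two (Real.iSup_nonneg fun _ => abs_nonneg _))

theorem integrable_of_unit {E : Type*} [MeasurableSpace E] (μ : Measure E) [IsFiniteMeasure μ]
    {h : E → ℝ} (hmeas : Measurable h) (h01 : ∀ x, 0 ≤ h x ∧ h x ≤ 1) : Integrable h μ :=
  Integrable.of_bound hmeas.aestronglyMeasurable 1 <| Eventually.of_forall fun x => by
    rw [Real.norm_eq_abs, abs_le]
    exact ⟨by linarith [(h01 x).1], (h01 x).2⟩

theorem integral_mem_unit {E : Type*} [MeasurableSpace E] (μ : Measure E) [IsProbabilityMeasure μ]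
    {h : E → ℝ} (hmeas : Measurable h) (h01 : ∀ x, 0 ≤ h x ∧ h x ≤ 1) :
    0 ≤ ∫ x, h x ∂μ ∧ ∫ x, h x ∂μ ≤ 1 :=
  ⟨integral_nonneg fun x => (h01 x).1, by
    simpa using integral_mono (integrable_of_unit μ hmeas h01) (integrable_const 1)
      fun x => (h01 x).2⟩

/-- Replacing h by f costs one sup norm under each measure, whence the factor 2; the integrals of f
are then compared level by level. -/
theorem abs_integral_sub_integral_le {E : Type*} [MeasurableSpace E] (μ ν : Measure E)
    [IsProbabilityMeasure μ] [IsProbabilityMeasure ν] {h : E → ℝ} (hmeas : Measurable h)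
    (h01 : ∀ x, 0 ≤ h x ∧ h x ≤ 1) (f : UnitSimple E) :
    |∫ x, h x ∂μ - ∫ x, h x ∂ν| ≤
      ∑ y ∈ f.1.range, y * |μ.real (f.1 ⁻¹' {y}) - ν.real (f.1 ⁻¹' {y})|
        + 2 * ⨆ x, |h x - f.1 x| := by
  -- An unbounded real supremum would default to 0.
  have hbdd : BddAbove (Set.range fun x => |h x - f.1 x|) := by
    refine ⟨1, ?_⟩
    rintro _ ⟨x, rfl⟩
    rw [abs_le]
    constructor <;> linarith [(h01 x).1, (h01 x).2, (f.2 x).1, (f.2 x).2]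
  have happrox : ∀ (ρ : Measure E) [IsProbabilityMeasure ρ],
      |∫ x, h x ∂ρ - ∫ x, f.1 x ∂ρ| ≤ ⨆ x, |h x - f.1 x| := by
    intro ρ _
    rw [← integral_sub (integrable_of_unit ρ hmeas h01) (integrable_of_unit ρ f.1.measurable f.2)]
    have := norm_integral_le_of_norm_le_const (μ := ρ) (f := fun x => h x - f.1 x)
      (Eventually.of_forall fun x => le_ciSup hbdd x)
    simpa using this
  have hint : ∀ (ρ : Measure E) [IsProbabilityMeasure ρ],
      ∫ x, f.1 x ∂ρ = ∑ y ∈ f.1.range, y * ρ.real (f.1 ⁻¹' {y}) := by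
    intro ρ _
    rw [← SimpleFunc.integral_eq_integral _ (integrable_of_unit ρ f.1.measurable f.2),
      SimpleFunc.integral_eq]
    simp only [smul_eq_mul, mul_comm]
  have hsimple : |∫ x, f.1 x ∂μ - ∫ x, f.1 x ∂ν| ≤
      ∑ y ∈ f.1.range, y * |μ.real (f.1 ⁻¹' {y}) - ν.real (f.1 ⁻¹' {y})| := by
    rw [hint μ, hint ν, ← Finset.sum_sub_distrib]
    refine (Finset.abs_sum_le_sum_abs _ _).trans (Finset.sum_le_sum fun y hy => ?_)
    obtain ⟨x, rfl⟩ := SimpleFunc.mem_range.1 hy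
    rw [← mul_sub, abs_mul, abs_of_nonneg (f.2 x).1]
  have h1 := happrox μ
  have h2 := happrox ν
  rw [abs_le] at *
  constructor <;> linarith [h1.1, h1.2, h2.1, h2.2, hsimple.1, hsimple.2]

theorem measurable_integral_kernel {Ω E : Type*} [MeasurableSpace Ω] [MeasurableSpace E]
    (κ : Kernel Ω E) [IsMarkovKernel κ] {h : E → ℝ} (hmeas : Measurable h) :
    Measurable fun ω => ∫ x, h x ∂(κ ω) :=
  (hmeas.stronglyMeasurable.integral_kernel (κ := κ)).measurable

/-- For fixed f the pointwise estimate is averaged over ω, and `smooth` is applied to each level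
set. -/
theorem IsDirectingProcess.integral_abs_sub_le {Ω E T : Type*} [MeasurableSpace Ω]
    [MeasurableSpace E] {P : Measure Ω} [IsProbabilityMeasure P] {X : T → Ω → E} {d : T → T → ℝ}
    {G : T → Kernel Ω E} (hG : IsDirectingProcess P X d G) {h : E → ℝ} (hmeas : Measurable h)
    (h01 : ∀ x, 0 ≤ h x ∧ h x ≤ 1) (s t : T) :
    ∫ ω, |∫ x, h x ∂(G s ω) - ∫ x, h x ∂(G t ω)| ∂P ≤ bCoef d h s t := by
  have := hG.prob s
  have := hG.prob t
  have : Nonempty (UnitSimple E) := ⟨⟨0, fun x => by simp⟩⟩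
  refine le_ciInf fun f => ?_
  have hreal : ∀ (r : T) (y : ℝ), Measurable fun ω => (G r ω).real (f.1 ⁻¹' {y}) := fun r y =>
    ((G r).measurable_coe (f.1.measurableSet_fiber y)).ennreal_toReal
  have hi : ∀ y, Integrable
      (fun ω => y * |(G s ω).real (f.1 ⁻¹' {y}) - (G t ω).real (f.1 ⁻¹' {y})|) P := by
    intro y
    refine Integrable.const_mul ?_ y
    refine Integrable.of_bound ((hreal s y).sub (hreal t y)).abs.aestronglyMeasurable 1 ?_
    refine Eventually.of_forall fun ω => ?_
    have h1 := measureReal_le_one (μ := G s ω) (s := f.1 ⁻¹' {y})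
    have h2 := measureReal_le_one (μ := G t ω) (s := f.1 ⁻¹' {y})
    have h3 := measureReal_nonneg (μ := G s ω) (s := f.1 ⁻¹' {y})
    have h4 := measureReal_nonneg (μ := G t ω) (s := f.1 ⁻¹' {y})
    rw [Real.norm_eq_abs, abs_abs, abs_le]
    constructor <;> linarith
  calc ∫ ω, |∫ x, h x ∂(G s ω) - ∫ x, h x ∂(G t ω)| ∂P
      ≤ ∫ ω, (∑ y ∈ f.1.range, y * |(G s ω).real (f.1 ⁻¹' {y}) - (G t ω).real (f.1 ⁻¹' {y})|
        + 2 * ⨆ x, |h x - f.1 x|) ∂P :=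
        integral_mono_of_nonneg (Eventually.of_forall fun ω => abs_nonneg _)
          ((integrable_finsetSum _ fun y _ => hi y).add (integrable_const _))
          (Eventually.of_forall fun ω => abs_integral_sub_integral_le _ _ hmeas h01 f)
    _ = ∑ y ∈ f.1.range, y * ∫ ω, |(G s ω).real (f.1 ⁻¹' {y}) - (G t ω).real (f.1 ⁻¹' {y})| ∂P
        + 2 * ⨆ x, |h x - f.1 x| := by
        rw [integral_add (integrable_finsetSum _ fun y _ => hi y) (integrable_const _),
          integral_finsetSum _ fun y _ => hi y]
        simp [integral_const_mul]
    _ ≤ levelSum f.1 * d s t + 2 * ⨆ x, |h x - f.1 x| := by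
        gcongr
        rw [levelSum, Finset.sum_mul]
        refine Finset.sum_le_sum fun y hy => ?_
        obtain ⟨x, rfl⟩ := SimpleFunc.mem_range.1 hy
        exact mul_le_mul_of_nonneg_left (hG.smooth s t _ (f.1.measurableSet_fiber _)) (f.2 x).1

/-! ### Conditional independence -/

/-- Boxes determine the joint law of (Z, X, Y), which is therefore the law of Z composed with κ × η.
For fixed z the integral factorises into two centred means. Keeping Z general allows conditioning on
a smaller sigma-algebra. -/
theorem integral_centered_mul_eq_zero {Ω Ω' E : Type*} [MeasurableSpace Ω] [MeasurableSpace Ω']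
    [MeasurableSpace E] (P : Measure Ω) [IsProbabilityMeasure P] {Z : Ω → Ω'} (hZ : Measurable Z)
    (κ η : Kernel Ω' E) [IsMarkovKernel κ] [IsMarkovKernel η] {X Y : Ω → E} (hX : Measurable X)
    (hY : Measurable Y)
    (hlaw : ∀ C A B, MeasurableSet C → MeasurableSet A → MeasurableSet B →
      P (Z ⁻¹' C ∩ (X ⁻¹' A ∩ Y ⁻¹' B)) = ∫⁻ ω in Z ⁻¹' C, κ (Z ω) A * η (Z ω) B ∂P)
    {u : E → ℝ} (hu : Measurable u) (u01 : ∀ x, 0 ≤ u x ∧ u x ≤ 1) :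
    ∫ ω, (u (X ω) - ∫ x, u x ∂(κ (Z ω))) * (u (Y ω) - ∫ x, u x ∂(η (Z ω))) ∂P = 0 := by
  have : IsProbabilityMeasure (P.map Z) := Measure.isProbabilityMeasure_map hZ.aemeasurable
  have hXYZ : Measurable fun ω => (Z ω, X ω, Y ω) := hZ.prodMk (hX.prodMk hY)
  have hmap : P.map (fun ω => (Z ω, X ω, Y ω)) = (P.map Z) ⊗ₘ (κ ×ₖ η) := by
    have : IsProbabilityMeasure (P.map fun ω => (Z ω, X ω, Y ω)) :=
      Measure.isProbabilityMeasure_map hXYZ.aemeasurable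
    refine Measure.ext_prod₃ fun {C A B} hC hA hB => ?_
    rw [Measure.map_apply hXYZ (hC.prod (hA.prod hB)),
      Measure.compProd_apply_prod hC (hA.prod hB)]
    simp only [Kernel.prod_apply_prod]
    have hm : Measurable fun z => κ z A * η z B := (κ.measurable_coe hA).mul (η.measurable_coe hB)
    rw [setLIntegral_map hC hm hZ]
    exact hlaw C A B hC hA hB
  set F : Ω' × E × E → ℝ := fun p =>
    (u p.2.1 - ∫ x, u x ∂(κ p.1)) * (u p.2.2 - ∫ x, u x ∂(η p.1)) with hF
  have hFm : Measurable F :=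
    ((hu.comp measurable_snd.fst).sub ((measurable_integral_kernel κ hu).comp measurable_fst)).mul
      ((hu.comp measurable_snd.snd).sub ((measurable_integral_kernel η hu).comp measurable_fst))
  have hFi : Integrable F ((P.map Z) ⊗ₘ (κ ×ₖ η)) := by
    refine Integrable.of_bound hFm.aestronglyMeasurable 1 (Eventually.of_forall fun p => ?_)
    have h1 := integral_mem_unit (κ p.1) hu u01
    have h2 := integral_mem_unit (η p.1) hu u01
    rw [hF, Real.norm_eq_abs, abs_mul]
    refine mul_le_one₀ ?_ (abs_nonneg _) ?_ <;> rw [abs_le]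
    · constructor <;> linarith [(u01 p.2.1).1, (u01 p.2.1).2]
    · constructor <;> linarith [(u01 p.2.2).1, (u01 p.2.2).2]
  calc ∫ ω, (u (X ω) - ∫ x, u x ∂(κ (Z ω))) * (u (Y ω) - ∫ x, u x ∂(η (Z ω))) ∂P
      = ∫ p, F p ∂(P.map fun ω => (Z ω, X ω, Y ω)) :=
        (integral_map hXYZ.aemeasurable hFm.aestronglyMeasurable).symm
    _ = ∫ z, ∫ q, F (z, q) ∂((κ ×ₖ η) z) ∂(P.map Z) := by
        rw [hmap, Measure.integral_compProd hFi]
    _ = 0 := by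
        refine integral_eq_zero_of_ae (Eventually.of_forall fun z => ?_)
        have h0 : ∫ x, (u x - ∫ x, u x ∂(κ z)) ∂(κ z) = 0 := by
          rw [integral_sub (integrable_of_unit _ hu u01) (integrable_const _)]
          simp
        simp only [hF, Pi.zero_apply, Kernel.prod_apply]
        rw [integral_prod_mul (fun x => u x - ∫ x, u x ∂(κ z)) (fun x => u x - ∫ x, u x ∂(η z)),
          h0, zero_mul]

theorem sigmaOf_le {Ω E T : Type*} [MeasurableSpace Ω] [MeasurableSpace E] (G : T → Kernel Ω E) :
    sigmaOf G ≤ ‹MeasurableSpace Ω› :=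
  iSup_le fun t => (G t).measurable.comap_le

/-- The kernel `G t`, regarded as measurable with respect to the sigma-algebra generated by `G`. -/
def coarseKernel {Ω E T : Type*} [MeasurableSpace Ω] [MeasurableSpace E] (G : T → Kernel Ω E)
    (t : T) : @Kernel Ω E (sigmaOf G) _ :=
  @Kernel.mk Ω E (sigmaOf G) _ (fun ω => G t ω)
    ((comap_measurable fun ω => G t ω).mono (le_iSup (fun t => MeasurableSpace.comap
      (fun ω => G t ω) inferInstance) t) le_rfl)

/-- This puts `cond` in the box form needed for conditional independence: it is applied to a
rectangle over {s, t} and integrated over C. -/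
theorem IsDirectingProcess.measureReal_inter {Ω E T : Type*} [MeasurableSpace Ω]
    [MeasurableSpace E] {P : Measure Ω} [IsProbabilityMeasure P] {X : T → Ω → E} {d : T → T → ℝ}
    {G : T → Kernel Ω E} (hG : IsDirectingProcess P X d G) (hX : ∀ t, Measurable (X t)) {s t : T}
    (hst : s ≠ t) {C : Set Ω} (hC : MeasurableSet[sigmaOf G] C) {A B : Set E}
    (hA : MeasurableSet A) (hB : MeasurableSet B) :
    P.real (C ∩ (X s ⁻¹' A ∩ X t ⁻¹' B)) = ∫ ω in C, (G s ω).real A * (G t ω).real B ∂P := by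
  classical
  have := hG.prob
  let V : T → Set E := fun i => if i = s then A else B
  let S : Finset T := {s, t}
  have hV : ∀ i, MeasurableSet (V i) := fun i => by
    simp only [V]
    split_ifs
    exacts [hA, hB]
  have hpre : (fun ω (i : S) => X i ω) ⁻¹' (Set.univ.pi fun i : S => V i)
      = X s ⁻¹' A ∩ X t ⁻¹' B := by
    ext ω
    simp only [S, V, Set.mem_preimage, Set.mem_univ_pi, Subtype.forall, Finset.mem_insert,
      Finset.mem_singleton, Set.mem_inter_iff]
    refine ⟨fun H => ⟨by simpa using H s (Or.inl rfl), by simpa [hst.symm] using H t (Or.inr rfl)⟩,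
      ?_⟩
    rintro ⟨hs, ht⟩ i (rfl | rfl)
    · simpa using hs
    · simpa [hst.symm] using ht
  have hpi : ∀ ω, (Measure.pi fun i : S => G i ω).real (Set.univ.pi fun i : S => V i)
      = (G s ω).real A * (G t ω).real B := by
    intro ω
    rw [Measure.real, Measure.pi_pi, Finset.prod_coe_sort S fun i => G i ω (V i),
      Finset.prod_pair hst, ENNReal.toReal_mul]
    simp [V, hst.symm, Measure.real]
  have hD : MeasurableSet (X s ⁻¹' A ∩ X t ⁻¹' B) := (hX s hA).inter (hX t hB)
  have hcond := hG.cond S _ (MeasurableSet.univ_pi fun i : S => hV i)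
  rw [hpre] at hcond
  simp only [hpi] at hcond
  rw [← setIntegral_congr_ae (sigmaOf_le G _ hC) (hcond.mono fun ω hω _ => hω),
    setIntegral_condExp (sigmaOf_le G) ((integrable_const 1).indicator hD) hC,
    setIntegral_indicator hD]
  simp

theorem IsDirectingProcess.integral_centered_mul {Ω E T : Type*} [MeasurableSpace Ω]
    [MeasurableSpace E] {P : Measure Ω} [IsProbabilityMeasure P] {X : T → Ω → E} {d : T → T → ℝ}
    {G : T → Kernel Ω E} (hG : IsDirectingProcess P X d G) (hX : ∀ t, Measurable (X t))
    {h : E → ℝ} (hmeas : Measurable h) (h01 : ∀ x, 0 ≤ h x ∧ h x ≤ 1) {s t : T} (hst : s ≠ t) :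
    ∫ ω, (h (X s ω) - ∫ x, h x ∂(G s ω)) * (h (X t ω) - ∫ x, h x ∂(G t ω)) ∂P = 0 := by
  have := hG.prob
  -- Z is the identity, with the sigma-algebra generated by G on its target; the kernels must be
  -- measurable for that one, hence `coarseKernel`.
  refine @integral_centered_mul_eq_zero Ω Ω E _ (sigmaOf G) _ P _ id
    (measurable_id'' (sigmaOf_le G)) (coarseKernel G s) (coarseKernel G t)
    (@IsMarkovKernel.mk _ _ (sigmaOf G) _ _ fun ω => (hG.prob s).isProbabilityMeasure ω)
    (@IsMarkovKernel.mk _ _ (sigmaOf G) _ _ fun ω => (hG.prob t).isProbabilityMeasure ω)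
    (X s) (X t) (hX s) (hX t) (fun C A B hC hA hB => ?_) h hmeas h01
  change P (C ∩ (X s ⁻¹' A ∩ X t ⁻¹' B)) = ∫⁻ ω in C, G s ω A * G t ω B ∂P
  have hr : ∀ (r : T) {A : Set E}, MeasurableSet A → Measurable fun ω => (G r ω).real A :=
    fun r A hA => ((G r).measurable_coe hA).ennreal_toReal
  have hi : Integrable (fun ω => (G s ω).real A * (G t ω).real B) (P.restrict C) := by
    refine Integrable.of_bound ((hr s hA).mul (hr t hB)).aestronglyMeasurable 1
      (Eventually.of_forall fun ω => ?_)
    rw [Real.norm_eq_abs, abs_of_nonneg (by positivity)]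
    exact mul_le_one₀ measureReal_le_one measureReal_nonneg measureReal_le_one
  rw [← ofReal_measureReal, hG.measureReal_inter hX hst hC hA hB,
    ofReal_integral_eq_lintegral_ofReal hi (Eventually.of_forall fun ω => by positivity)]
  refine lintegral_congr fun ω => ?_
  rw [ENNReal.ofReal_mul measureReal_nonneg, ofReal_measureReal, ofReal_measureReal]

/-! ### Consistency of the weighted empirical measure -/

/-- This is nonnegativity of the variance of |Y|. -/
theorem integral_abs_le_sqrt {Ω : Type*} [MeasurableSpace Ω] (P : Measure Ω)
    [IsProbabilityMeasure P] {Y : Ω → ℝ} (hY : MemLp Y 2 P) :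
    ∫ ω, |Y ω| ∂P ≤ √(∫ ω, Y ω ^ 2 ∂P) := by
  have h1 : Integrable (fun ω => |Y ω|) P := (hY.integrable one_le_two).abs
  have h2 : Integrable (fun ω => Y ω ^ 2) P := hY.integrable_sq
  refine Real.le_sqrt_of_sq_le ?_
  set c := ∫ ω, |Y ω| ∂P with hc
  have h3 : 0 ≤ ∫ ω, (|Y ω| - c) ^ 2 ∂P := integral_nonneg fun ω => sq_nonneg _
  have h4 : ∀ ω, (|Y ω| - c) ^ 2 = Y ω ^ 2 - 2 * c * |Y ω| + c ^ 2 := fun ω => by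
    rw [sub_sq, sq_abs]
    ring
  simp_rw [h4] at h3
  have h5 : Integrable (fun ω => Y ω ^ 2 - 2 * c * |Y ω|) P := h2.sub (h1.const_mul _)
  rw [integral_add h5 (integrable_const _),
    integral_sub h2 (h1.const_mul _), integral_const_mul, ← hc] at h3
  simp only [integral_const, probReal_univ, one_smul] at h3
  linarith

/-- Orthogonality kills the off-diagonal terms of the expanded square, and each diagonal integral is
at most 1. -/
theorem integral_sq_sum_le {Ω : Type*} [MeasurableSpace Ω] (P : Measure Ω)
    [IsProbabilityMeasure P] {N : ℕ} {D : Fin N → Ω → ℝ} (hD : ∀ n, Measurable (D n))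
    (hD1 : ∀ n ω, |D n ω| ≤ 1) (horth : ∀ m n, m ≠ n → ∫ ω, D m ω * D n ω ∂P = 0)
    (ξ : Fin N → ℝ) : ∫ ω, (∑ n, ξ n * D n ω) ^ 2 ∂P ≤ ∑ n, ξ n ^ 2 := by
  have hi : ∀ m n, Integrable (fun ω => D m ω * D n ω) P := fun m n =>
    Integrable.of_bound ((hD m).mul (hD n)).aestronglyMeasurable 1 <|
      Eventually.of_forall fun ω => by
        rw [Real.norm_eq_abs, abs_mul]
        exact mul_le_one₀ (hD1 m ω) (abs_nonneg _) (hD1 n ω)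
  have hexp : ∀ ω, (∑ n, ξ n * D n ω) ^ 2
      = ∑ m, ∑ n, ξ m * ξ n * (D m ω * D n ω) := fun ω => by
    rw [sq, Finset.sum_mul_sum]
    exact Finset.sum_congr rfl fun m _ => Finset.sum_congr rfl fun n _ => by ring
  simp_rw [hexp]
  rw [integral_finsetSum _ fun m _ => integrable_finsetSum _ fun n _ => (hi m n).const_mul _]
  refine Finset.sum_le_sum fun m _ => ?_
  rw [integral_finsetSum _ fun n _ => (hi m n).const_mul _,
    Finset.sum_eq_single m (fun n _ hn => by rw [integral_const_mul, horth m n hn.symm, mul_zero])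
      (by simp), integral_const_mul, ← sq]
  refine mul_le_of_le_one_right (sq_nonneg _) ?_
  calc ∫ ω, D m ω * D m ω ∂P ≤ ∫ _, (1 : ℝ) ∂P :=
        integral_mono (hi m m) (integrable_const _) fun ω => by
          have := hD1 m ω
          rw [← sq]
          exact (sq_le_one_iff_abs_le_one _).2 this
    _ = 1 := by simp

/-- Nonnegative weights are essential, since `ENNReal.ofReal` truncates negative ones to 0. -/
theorem integral_localEmpirical {E : Type*} [MeasurableSpace E] {N : ℕ} {ξ : Fin N → ℝ}
    (hξ : ∀ n, 0 ≤ ξ n) (x : Fin N → E) {h : E → ℝ} (hmeas : Measurable h)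
    (h01 : ∀ x, 0 ≤ h x ∧ h x ≤ 1) :
    ∫ y, h y ∂(localEmpirical ξ x) = ∑ n, ξ n * h (x n) := by
  unfold localEmpirical
  rw [integral_finsetSum_measure fun n _ =>
    (integrable_of_unit _ hmeas h01).smul_measure ENNReal.ofReal_ne_top]
  refine Finset.sum_congr rfl fun n _ => ?_
  rw [integral_smul_measure, integral_dirac' _ _ hmeas.stronglyMeasurable,
    ENNReal.toReal_ofReal (hξ n), smul_eq_mul]

theorem IsDirectingProcess.integral_abs_error_le {Ω E T : Type*} [MeasurableSpace Ω]
    [MeasurableSpace E] {P : Measure Ω} [IsProbabilityMeasure P] {X : T → Ω → E} {d : T → T → ℝ}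
    {G : T → Kernel Ω E} (hG : IsDirectingProcess P X d G) (hX : ∀ t, Measurable (X t))
    {h : E → ℝ} (hmeas : Measurable h) (h01 : ∀ x, 0 ≤ h x ∧ h x ≤ 1) (τ : T) {N : ℕ}
    {t : Fin N → T} (ht : Function.Injective t) {ξ : Fin N → ℝ} (hξ : ∀ n, 0 ≤ ξ n)
    (hξ1 : ∑ n, ξ n = 1) :
    ∫ ω, |∑ n, ξ n * h (X (t n) ω) - ∫ x, h x ∂(G τ ω)| ∂P
      ≤ √(∑ n, ξ n ^ 2) + ∑ n, ξ n * bCoef d h (t n) τ := by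
  have := hG.prob
  set g : T → Ω → ℝ := fun s ω => ∫ x, h x ∂(G s ω) with hg
  have hgm : ∀ s, Measurable (g s) := fun s => measurable_integral_kernel (G s) hmeas
  have hg01 : ∀ s ω, 0 ≤ g s ω ∧ g s ω ≤ 1 := fun s ω => integral_mem_unit _ hmeas h01
  set D : Fin N → Ω → ℝ := fun n ω => h (X (t n) ω) - g (t n) ω with hDdef
  have hDm : ∀ n, Measurable (D n) := fun n => (hmeas.comp (hX _)).sub (hgm _)
  have hD1 : ∀ n ω, |D n ω| ≤ 1 := fun n ω => by
    rw [abs_le]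
    constructor <;> simp only [hDdef] <;>
      linarith [(h01 (X (t n) ω)).1, (h01 (X (t n) ω)).2, (hg01 (t n) ω).1, (hg01 (t n) ω).2]
  have hDp : MemLp (fun ω => ∑ n, ξ n * D n ω) 2 P :=
    memLp_finsetSum _ fun n _ => (MemLp.of_bound (hDm n).aestronglyMeasurable 1
      (Eventually.of_forall (hD1 n))).const_mul (ξ n)
  have hbi : ∀ n, Integrable (fun ω => ξ n * |g (t n) ω - g τ ω|) P := fun n =>
    ((integrable_of_unit P (hgm _) (hg01 _)).sub (integrable_of_unit P (hgm _) (hg01 _))).abs.const_mul _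
  have hpt : ∀ ω, |∑ n, ξ n * h (X (t n) ω) - g τ ω|
      ≤ |∑ n, ξ n * D n ω| + ∑ n, ξ n * |g (t n) ω - g τ ω| := by
    intro ω
    -- Noise plus bias; mass 1 allows G_τ(h) to be moved inside the weighted sum.
    have h1 : ∑ n, ξ n * h (X (t n) ω) - g τ ω
        = ∑ n, ξ n * D n ω + ∑ n, ξ n * (g (t n) ω - g τ ω) := by
      simp only [hDdef, mul_sub, Finset.sum_sub_distrib, ← Finset.sum_mul, hξ1]
      ring
    rw [h1]
    refine (abs_add_le _ _).trans (add_le_add le_rfl ?_)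
    refine (Finset.abs_sum_le_sum_abs _ _).trans_eq (Finset.sum_congr rfl fun n _ => ?_)
    rw [abs_mul, abs_of_nonneg (hξ n)]
  calc ∫ ω, |∑ n, ξ n * h (X (t n) ω) - g τ ω| ∂P
      ≤ ∫ ω, (|∑ n, ξ n * D n ω| + ∑ n, ξ n * |g (t n) ω - g τ ω|) ∂P :=
        integral_mono_of_nonneg (Eventually.of_forall fun ω => abs_nonneg _)
          ((hDp.integrable one_le_two).abs.add (integrable_finsetSum _ fun n _ => hbi n))
          (Eventually.of_forall hpt)
    _ = ∫ ω, |∑ n, ξ n * D n ω| ∂P + ∑ n, ξ n * ∫ ω, |g (t n) ω - g τ ω| ∂P := by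
        rw [integral_add (hDp.integrable one_le_two).abs (integrable_finsetSum _ fun n _ => hbi n),
          integral_finsetSum _ fun n _ => hbi n]
        simp only [integral_const_mul]
    _ ≤ √(∑ n, ξ n ^ 2) + ∑ n, ξ n * bCoef d h (t n) τ := by
        refine add_le_add ((integral_abs_le_sqrt P hDp).trans (Real.sqrt_le_sqrt ?_))
          (Finset.sum_le_sum fun n _ => mul_le_mul_of_nonneg_left
            (hG.integral_abs_sub_le hmeas h01 _ _) (hξ n))
        exact integral_sq_sum_le P hDm hD1 (fun m n hmn =>
          hG.integral_centered_mul hX hmeas h01 (ht.ne hmn)) ξ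

end LocalExch

/-! ### Convergence of the bounds and consistency of the estimator -/

theorem mainTheorem8 {Ω E T : Type*} [MeasurableSpace Ω] (P : Measure Ω) [IsProbabilityMeasure P]
    [MeasurableSpace E] [StandardBorelSpace E]
    (d : T → T → ℝ) (hd : LocalExch.IsPremetric d) (hsep : LocalExch.InfinitelySeparable d)
    (X : T → Ω → E) (hX : ∀ t, Measurable (X t)) (hloc : LocalExch.LocallyExchangeable P X d)
    (h : E → ℝ) (hmeas : Measurable h) (h01 : ∀ x, 0 ≤ h x ∧ h x ≤ 1)
    (τ : T) (t : ℕ → T) (ht : Function.Injective t)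
    -- `σ N` sorts the first `N` covariates by their coefficients, ties broken arbitrarily
    (σ : ∀ N, Equiv.Perm (Fin N)) (hσ : ∀ N, Monotone (LocalExch.coefs d h t τ N ∘ σ N))
    -- `ξ N` are the weights that the algorithm returns for the first `N` covariates
    (ξ : ∀ N, Fin N → ℝ)
    (hξ : ∀ N, ξ N = LocalExch.algWeights (LocalExch.coefs d h t τ N) (σ N)) :
    (Tendsto (fun N => LocalExch.sqErrorBound (ξ N) (LocalExch.coefs d h t τ N)) atTop (𝓝 0) ↔
      ∃ φ : ℕ → ℕ, StrictMono φ ∧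
        Tendsto (fun i => LocalExch.bCoef d h (t (φ i)) τ) atTop (𝓝 0)) ∧
    (∀ δ : ℝ, 0 < δ →
      (Tendsto (fun N => LocalExch.tailBound (ξ N) (LocalExch.coefs d h t τ N) δ) atTop (𝓝 0) ↔
        ∃ φ : ℕ → ℕ, StrictMono φ ∧
          Tendsto (fun i => LocalExch.bCoef d h (t (φ i)) τ) atTop (𝓝 0))) ∧
    ((∃ φ : ℕ → ℕ, StrictMono φ ∧
        Tendsto (fun i => LocalExch.bCoef d h (t (φ i)) τ) atTop (𝓝 0)) →
      ∀ G : T → Kernel Ω E, LocalExch.IsDirectingProcess P X d G →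
        TendstoInMeasure P
          (fun N ω => ∫ x, h x ∂(LocalExch.localEmpirical (ξ N) (fun n => X (t n) ω)))
          atTop (fun ω => ∫ x, h x ∂(G τ ω))) := by
  have hb : ∀ n, 0 ≤ LocalExch.bCoef d h (t n) τ := fun n => LocalExch.bCoef_nonneg hd h _ _
  have hopt : ∀ N, 0 < N → LocalExch.IsOptimal (ξ N) fun n => LocalExch.bCoef d h (t n) τ :=
    fun N hN => by
      rw [hξ N]
      exact LocalExch.isOptimal_algWeights hN _ (σ N) (hσ N)
  have hiff : (Tendsto (fun N => ∑ n, ξ N n ^ 2) atTop (𝓝 0) ∧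
      Tendsto (fun N => ∑ n, ξ N n * LocalExch.bCoef d h (t n) τ) atTop (𝓝 0)) ↔
      ∃ φ : ℕ → ℕ, StrictMono φ ∧
        Tendsto (fun i => LocalExch.bCoef d h (t (φ i)) τ) atTop (𝓝 0) :=
    ⟨fun hQR => LocalExch.exists_subseq_of_tendsto hb hopt hQR.1 hQR.2,
      fun hφ => (LocalExch.tendsto_sqErrorBound_iff hb hopt).1
        (LocalExch.tendsto_sqErrorBound hb hopt hφ)⟩
  refine ⟨(LocalExch.tendsto_sqErrorBound_iff hb hopt).trans hiff,
    fun δ hδ => (LocalExch.tendsto_tailBound_iff hb hopt hδ).trans hiff, fun hφ G hG => ?_⟩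
  obtain ⟨hQ, hR⟩ := hiff.2 hφ
  have hprob := hG.prob
  have hlim : Tendsto (fun N => √(∑ n, ξ N n ^ 2)
      + ∑ n, ξ N n * LocalExch.bCoef d h (t n) τ) atTop (𝓝 0) := by
    simpa using hQ.sqrt.add hR
  have hgm : Measurable fun ω => ∫ x, h x ∂(G τ ω) :=
    LocalExch.measurable_integral_kernel (G τ) hmeas
  have hem : ∀ N, Measurable fun ω => ∑ n, ξ N n * h (X (t n) ω) := fun N =>
    Finset.measurable_fun_sum _ fun n _ => (hmeas.comp (hX _)).const_mul _
  have hmain : TendstoInMeasure P (fun N ω => ∑ n, ξ N n * h (X (t n) ω)) atTop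
      (fun ω => ∫ x, h x ∂(G τ ω)) := by
    -- Convergence in L¹ implies convergence in probability.
    refine tendstoInMeasure_of_tendsto_eLpNorm one_ne_zero
      (fun N => (hem N).aestronglyMeasurable) hgm.aestronglyMeasurable ?_
    refine tendsto_of_tendsto_of_tendsto_of_le_of_le' tendsto_const_nhds
      (by simpa using ENNReal.tendsto_ofReal hlim) (Eventually.of_forall fun _ => zero_le) ?_
    filter_upwards [eventually_gt_atTop 0] with N hN
    have hi : Integrable (fun ω => ∑ n, ξ N n * h (X (t n) ω) - ∫ x, h x ∂(G τ ω)) P :=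
      (integrable_finsetSum _ fun n _ => (LocalExch.integrable_of_unit P (hmeas.comp (hX _))
        fun ω => h01 _).const_mul _).sub
        (LocalExch.integrable_of_unit P hgm fun ω => LocalExch.integral_mem_unit _ hmeas h01)
    rw [eLpNorm_one_eq_lintegral_enorm]
    refine (ofReal_integral_norm_eq_lintegral_enorm hi).symm.trans_le (ENNReal.ofReal_le_ofReal ?_)
    exact hG.integral_abs_error_le hX hmeas h01 τ (ht.comp Fin.val_injective) (hopt N hN).nonneg
      (hopt N hN).sum_eq_one
  -- Optimality, and with it nonnegativity of the weights, is available for N > 0, so the sums and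
  -- the integrals are identified eventually.
  refine hmain.congr' ?_ EventuallyEq.rfl
  filter_upwards [eventually_gt_atTop 0] with N hN
  exact Eventually.of_forall fun ω =>
    (LocalExch.integral_localEmpirical (hopt N hN).nonneg _ hmeas h01).symm
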